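/- Let $F^{[2]}=\left(\begin{bmatrix}1&0\\0&-1\end{bmatrix},\begin{bmatrix}0&1\\1&0\end{bmatrix}\right)$ and, if $F^{[g]}=(F_1,\dots,F_g)$, let $$F^{[g+1]}=\left(F_1\otimes\begin{bmatrix}1&0\\0&-1\end{bmatrix},\dots,F_g\otimes\begin{bmatrix}1&0\\0&-1\end{bmatrix},\ I\otimes\begin{bmatrix}0&1\\1&0\end{bmatrix}\right).$$ Let $\mathcal D_{F^{[g]}}$ be the free spectrahedron whose level $n\ge 1$ consists of the $g$-tuples $X=(X_1,\dots,X_g)$ of self-adjoint $n\times n$ complex matrices with $I-\sum_{j=1}^g F_j\otimes X_j\succeq 0$. A matrix convex combination of $g$-tuples $X^{(1)},\dots,X^{(m)}$ of square complex matrices, where the matrices of $X^{(i)}$ have size $n_i\times n_i$, is a tuple $\sum_{i=1}^m V_i^*X^{(i)}V_i$ of $n \times n$ matrices where $V_i$ is an $n_i\times n$ complex matrix and $\sum_{i=1}^m V_i^*V_i=I_n$; a set $K$ of $g$-tuples of square complex matrices (of all sizes $n\ge1$) is matrix convex if it is closed under matrix convex combinations. A point $X\in K$ of $n\times n$ matrices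 is a free extreme point of $K$, of matrix dimension $n$, if whenever $X=\sum_{i=1}^m V_i^*X^{(i)}V_i$ is a matrix convex combination of points $X^{(i)}\in K$ with all $V_i\neq 0$, each $X^{(i)}$ is unitarily equivalent to $X$ or to a direct sum $X\oplus Z$ for some tuple $Z$ of matrices of size at least $1$. Then for every $g\ge 3$, $\mathcal D_{F^{[g]}}$ has a free extreme point of matrix dimension at least $6$. Moreover, $\mathcal D_{F^{[g]}}$ is not equal to $\mathcal W^{\min}(\overline{\mathbb B_g})$, the smallest matrix convex set whose first level is the closed Euclidean unit ball $\overline{\mathbb B_g}\subseteq\mathbb R^g$ (that is, the intersection of all matrix convex sets with that first level). -/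

import Mathlib

open scoped Kronecker ComplexOrder Matrix

/-- A set of `g`-tuples of square complex matrices, given level by level; the levels are
indexed by the matrix dimension `n = 1, 2, 3, …`. -/
abbrev MatrixSet (g : ℕ) : Type :=
  ∀ n : ℕ+, Set (Fin g → Matrix (Fin n) (Fin n) ℂ)

/-- `X` is the matrix convex combination `∑ i, (V i)ᴴ * Y i * V i` (with `∑ i, (V i)ᴴ * V i = 1`)
of the tuples `Y i`, whose dimensions `d i` may vary. -/
def IsMatrixConvexCombination {g m : ℕ} {n : ℕ+} (X : Fin g → Matrix (Fin n) (Fin n) ℂ)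
    (d : Fin m → ℕ+) (Y : ∀ i, Fin g → Matrix (Fin (d i)) (Fin (d i)) ℂ)
    (V : ∀ i, Matrix (Fin (d i)) (Fin n) ℂ) : Prop :=
  ∑ i, (V i)ᴴ * V i = 1 ∧ ∀ j, X j = ∑ i, (V i)ᴴ * Y i j * V i

/-- Closedness under matrix convex combinations. -/
def IsMatrixConvex {g : ℕ} (K : MatrixSet g) : Prop :=
  ∀ (m : ℕ) (n : ℕ+) (X : Fin g → Matrix (Fin n) (Fin n) ℂ) (d : Fin m → ℕ+)
    (Y : ∀ i, Fin g → Matrix (Fin (d i)) (Fin (d i)) ℂ) (V : ∀ i, Matrix (Fin (d i)) (Fin n) ℂ),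
    IsMatrixConvexCombination X d Y V → (∀ i, Y i ∈ K (d i)) → X ∈ K n

/-- Unitary equivalence of tuples; the index types may differ. -/
def UnitarilyEquivalent {g : ℕ} {α β : Type} [Fintype α] [DecidableEq α] [Fintype β]
    [DecidableEq β] (X : Fin g → Matrix α α ℂ) (Y : Fin g → Matrix β β ℂ) : Prop :=
  ∃ U : Matrix β α ℂ, Uᴴ * U = 1 ∧ U * Uᴴ = 1 ∧ ∀ j, X j = Uᴴ * Y j * U

/-- The direct sum of two tuples. -/
def tupleDirectSum {g : ℕ} {α β : Type} (X : Fin g → Matrix α α ℂ) (Z : Fin g → Matrix β β ℂ) :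
    Fin g → Matrix (α ⊕ β) (α ⊕ β) ℂ :=
  fun j => Matrix.fromBlocks (X j) 0 0 (Z j)

/-- `X` is a free extreme point, of matrix dimension `n`, of `K`: whenever `X` is a matrix convex
combination, with nonzero coefficients, of points of `K`, each of these points is unitarily
equivalent to `X` or to a direct sum `X ⊕ Z` with a tuple `Z` of dimension at least one. -/
def IsFreeExtremePoint {g : ℕ} (K : MatrixSet g) (n : ℕ+)
    (X : Fin g → Matrix (Fin n) (Fin n) ℂ) : Prop :=
  X ∈ K n ∧
    ∀ (m : ℕ) (d : Fin m → ℕ+) (Y : ∀ i, Fin g → Matrix (Fin (d i)) (Fin (d i)) ℂ)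
      (V : ∀ i, Matrix (Fin (d i)) (Fin n) ℂ),
      IsMatrixConvexCombination X d Y V → (∀ i, Y i ∈ K (d i)) → (∀ i, V i ≠ 0) →
        ∀ i, UnitarilyEquivalent (Y i) X ∨
          ∃ (k : ℕ+) (Z : Fin g → Matrix (Fin k) (Fin k) ℂ),
            UnitarilyEquivalent (Y i) (tupleDirectSum X Z)

/-- The free spectrahedron of a tuple `A` of matrices: the tuples `X` of self-adjoint matrices
with `1 - ∑ j, A j ⊗ X j` positive semidefinite. -/
def freeSpectrahedron {g : ℕ} {α : Type} [Fintype α] [DecidableEq α]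
    (A : Fin g → Matrix α α ℂ) : MatrixSet g :=
  fun _ => {X | (∀ j, (X j).IsHermitian) ∧ (1 - ∑ j, A j ⊗ₖ X j).PosSemidef}

/-- The index type of the matrices of the spin tuple of length `g`; it has `2 ^ (g - 1)` elements
if `2 ≤ g`. -/
def SpinIndex : ℕ → Type
  | 0 => Fin 2
  | 1 => Fin 2
  | 2 => Fin 2
  | g + 3 => SpinIndex (g + 2) × Fin 2

instance SpinIndex.instFintype : ∀ g, Fintype (SpinIndex g)
  | 0 => inferInstanceAs (Fintype (Fin 2))
  | 1 => inferInstanceAs (Fintype (Fin 2))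
  | 2 => inferInstanceAs (Fintype (Fin 2))
  | g + 3 =>
    letI := SpinIndex.instFintype (g + 2)
    inferInstanceAs (Fintype (SpinIndex (g + 2) × Fin 2))

instance SpinIndex.instDecidableEq : ∀ g, DecidableEq (SpinIndex g)
  | 0 => inferInstanceAs (DecidableEq (Fin 2))
  | 1 => inferInstanceAs (DecidableEq (Fin 2))
  | 2 => inferInstanceAs (DecidableEq (Fin 2))
  | g + 3 =>
    letI := SpinIndex.instDecidableEq (g + 2)
    inferInstanceAs (DecidableEq (SpinIndex (g + 2) × Fin 2))

/-- The matrix `diag(1, -1)`. -/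
def sigmaZ : Matrix (Fin 2) (Fin 2) ℂ := !![1, 0; 0, -1]

/-- The flip matrix. -/
def sigmaX : Matrix (Fin 2) (Fin 2) ℂ := !![0, 1; 1, 0]

/-- The tuple `F^{[g]}`, `2 ≤ g`, of universal pairwise anticommuting self-adjoint unitaries:
`F^{[2]} = (sigmaZ, sigmaX)`, and `F^{[g+1]}` consists of the `F_j ⊗ sigmaZ` for `F_j` in
`F^{[g]}`, followed by `1 ⊗ sigmaX`. (The values at `g = 0, 1` play no role.) -/
def spinTuple : (g : ℕ) → Fin g → Matrix (SpinIndex g) (SpinIndex g) ℂ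
  | 0 => Fin.elim0
  | 1 => fun _ => sigmaZ
  | 2 => ![sigmaZ, sigmaX]
  | g + 3 =>
    Fin.snoc (α := fun _ => Matrix (SpinIndex (g + 2) × Fin 2) (SpinIndex (g + 2) × Fin 2) ℂ)
      (fun j => spinTuple (g + 2) j ⊗ₖ sigmaZ) (1 ⊗ₖ sigmaX)

/-- The points of `C ⊆ ℝ^g`, seen as tuples of `1 × 1` matrices. -/
def levelOne {g : ℕ} (C : Set (EuclideanSpace ℝ (Fin g))) :
    Set (Fin g → Matrix (Fin (1 : ℕ+)) (Fin (1 : ℕ+)) ℂ) :=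
  {X | ∃ x ∈ C, ∀ j a b, X j a b = (x j : ℂ)}

/-- The smallest matrix convex set whose first level is the convex set `C`: the intersection of
all matrix convex sets with first level `C`. -/
def minimalMatrixConvexSet {g : ℕ} (C : Set (EuclideanSpace ℝ (Fin g))) : MatrixSet g :=
  fun n => {X | ∀ K : MatrixSet g, IsMatrixConvex K → K 1 = levelOne C → X ∈ K n}

/-! Write `T = ∑ A j ⊗ X j` for the spin tuple `A`. A point `X` is free extreme if it is irreducible
and no nonzero tuple `D` makes `∑ A j ⊗ D j` vanish on `ker (1 - T)`: in a matrix convex combination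
every `Y i * V i - V i * X` is such a `D`, so each `V i` intertwines `X` with `Y i` and is a
multiple of an isometry (`isFreeExtremePoint_of_kernel_condition`).

Points with `T ^ 3 = T` are tractable. The spectrum of `T` lies in `{-1, 0, 1}`, which gives
membership, and the range of `T ^ 2 + T` lies in the kernel. A unitary anticommuting with all `A j`
exchanges `T` and `-T`, so vanishing on the kernel forces `(∑ A j ⊗ D j) * T = 0`. By the Clifford
relations this means `D j * X k = D k * X j` and `∑ D j * X j = 0`. Likewise `T ^ 3 = T` becomes
cubic equations in the `X j` alone. An explicit irreducible triple of size 7, padded by zeros,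
solves the cubic equations and admits only `D = 0`.

Every point of the minimal matrix convex set is a matrix convex combination of scalar points, so its
free extreme points have dimension 1 (`IsFreeExtremePoint.eq_one_of_minimal`). A free extreme point
of dimension 7 therefore separates the two sets. -/

/-! ### A kernel criterion for free extreme points. -/

theorem sum_eq_zero_of_posSemidef {ι n : Type*} [Fintype ι] [Fintype n]
    {M : ι → Matrix n n ℂ} (hM : ∀ i, (M i).PosSemidef) (h : ∑ i, M i = 0) (i : ι) : M i = 0 := by
  have ht : ∑ i, (M i).trace = 0 := by rw [← Matrix.trace_sum, h, Matrix.trace_zero]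
  have := (Finset.sum_eq_zero_iff_of_nonneg fun i _ => (hM i).trace_nonneg).1 ht i (Finset.mem_univ i)
  exact (hM i).trace_eq_zero_iff.1 this

open scoped MatrixOrder in
theorem mul_eq_zero_of_posSemidef {m n : Type*} [Fintype m] [Fintype n]
    {L : Matrix m m ℂ} (hL : L.PosSemidef) (K : Matrix m n ℂ) (h : Kᴴ * L * K = 0) : L * K = 0 := by
  classical
  obtain ⟨B, rfl⟩ := CStarAlgebra.nonneg_iff_eq_star_mul_self.1 hL.nonneg
  rw [Matrix.star_eq_conjTranspose] at h ⊢
  have h1 : (B * K)ᴴ * (B * K) = 0 := by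
    rw [← h, Matrix.conjTranspose_mul]; simp only [Matrix.mul_assoc]
  rw [Matrix.mul_assoc, Matrix.conjTranspose_mul_self_eq_zero.1 h1, Matrix.mul_zero]

theorem card_eq_of_mul_eq_one {m n : Type*} [Fintype m] [Fintype n] [DecidableEq m] [DecidableEq n]
    {U : Matrix m n ℂ} (h1 : Uᴴ * U = 1) (h2 : U * Uᴴ = 1) : Fintype.card m = Fintype.card n := by
  have := Matrix.trace_mul_comm Uᴴ U
  rw [h1, h2, Matrix.trace_one, Matrix.trace_one] at this
  exact_mod_cast this.symm

theorem exists_unitary_extension {d n k : ℕ} (hd : n + k = d) (W : Matrix (Fin d) (Fin n) ℂ)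
    (hW : Wᴴ * W = 1) : ∃ Z : Matrix (Fin d) (Fin k) ℂ,
      (Matrix.fromCols W Z)ᴴ * Matrix.fromCols W Z = 1 ∧
      Matrix.fromCols W Z * (Matrix.fromCols W Z)ᴴ = 1 := by
  let w : Fin n → EuclideanSpace ℂ (Fin d) := fun j => WithLp.toLp 2 (W.col j)
  have hw : Orthonormal ℂ w := by
    rw [orthonormal_iff_ite]
    intro i j
    have := congrFun (congrFun hW i) j
    rw [Matrix.one_apply, Matrix.mul_apply] at this
    rw [← this]
    simp [w, PiLp.inner_apply, mul_comm]
  -- The zeros are placeholders: only the restriction to the left summand has to be orthonormal.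
  let v : Fin n ⊕ Fin k → EuclideanSpace ℂ (Fin d) := Sum.elim w 0
  have hv : Orthonormal ℂ ((Set.range Sum.inl).domRestrict v) := by
    let e := Equiv.ofInjective (Sum.inl : Fin n → Fin n ⊕ Fin k) Sum.inl_injective
    have : (Set.range Sum.inl).domRestrict v = w ∘ e.symm := by
      ext1 ⟨_, j, rfl⟩
      have : e.symm ⟨Sum.inl j, j, rfl⟩ = j := Equiv.ofInjective_symm_apply _ j
      rw [Function.comp_apply, this]
      rfl
    rw [this]
    exact hw.comp _ e.symm.injective
  obtain ⟨b, hb⟩ := hv.exists_orthonormalBasis_extension_of_card_eq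
    (by simp; omega)
  let Z : Matrix (Fin d) (Fin k) ℂ := Matrix.of fun a j => b (Sum.inr j) a
  have hU : Matrix.fromCols W Z = Matrix.of fun a j => b j a := by
    ext a (j | j)
    · have := congrArg (fun x => x.ofLp a) (hb (Sum.inl j) ⟨j, rfl⟩)
      simpa [v, w] using this.symm
    · simp [Z]
  have h1 : (Matrix.fromCols W Z)ᴴ * Matrix.fromCols W Z = 1 := by
    rw [hU]
    ext i j
    have := orthonormal_iff_ite.1 b.orthonormal i j
    rw [Matrix.one_apply, Matrix.mul_apply, ← this]
    simp [PiLp.inner_apply, mul_comm]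
  refine ⟨Z, h1, ?_⟩
  exact (Matrix.mul_eq_one_comm_of_card_eq _ _ _ (by simp; omega)).1 h1

/-- The range of `W` is invariant under the self-adjoint `Y j`, hence reducing; `Z` is the
compression of `Y` to its orthogonal complement. -/
theorem unitarilyEquivalent_of_isometry {g : ℕ} {d n : ℕ+} {Y : Fin g → Matrix (Fin d) (Fin d) ℂ}
    {X : Fin g → Matrix (Fin n) (Fin n) ℂ} (hY : ∀ j, (Y j).IsHermitian)
    (W : Matrix (Fin d) (Fin n) ℂ) (hW : Wᴴ * W = 1) (h : ∀ j, Y j * W = W * X j) :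
    UnitarilyEquivalent Y X ∨ ∃ (k : ℕ+) (Z : Fin g → Matrix (Fin k) (Fin k) ℂ),
      UnitarilyEquivalent Y (tupleDirectSum X Z) := by
  have hnd : (n : ℕ) ≤ d := by
    have := (Matrix.rank_mul_le_right Wᴴ W).trans (Matrix.rank_le_card_height W)
    simpa [hW, Matrix.rank_one] using this
  rcases hnd.eq_or_lt with hnd | hnd
  · left
    obtain rfl : n = d := PNat.eq hnd
    have hW' : W * Wᴴ = 1 := mul_eq_one_comm.1 hW
    refine ⟨Wᴴ, by simpa using hW', by simpa using hW, fun j => ?_⟩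
    rw [Matrix.conjTranspose_conjTranspose, ← h j, Matrix.mul_assoc, hW', Matrix.mul_one]
  · right
    obtain ⟨k, hk⟩ : ∃ k : ℕ+, (n : ℕ) + k = d := ⟨⟨d - n, by omega⟩, by simp; omega⟩
    obtain ⟨Z, h1, h2⟩ := exists_unitary_extension hk W hW
    refine ⟨k, fun j => Zᴴ * Y j * Z, (Matrix.fromCols W Z)ᴴ,
      by rw [Matrix.conjTranspose_conjTranspose]; exact h2,
      by rw [Matrix.conjTranspose_conjTranspose]; exact h1, fun j => ?_⟩
    have hZW : Zᴴ * W = 0 := by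
      have := h1
      rw [Matrix.conjTranspose_fromCols_eq_fromRows_conjTranspose, Matrix.fromRows_mul_fromCols,
        ← Matrix.fromBlocks_one, Matrix.fromBlocks_inj] at this
      exact this.2.2.1
    have hWZ : Wᴴ * Z = 0 := by
      have := congrArg Matrix.conjTranspose hZW
      simpa using this
    have hWY : Wᴴ * Y j = (X j)ᴴ * Wᴴ := by
      have := congrArg Matrix.conjTranspose (h j)
      simpa [(hY j).eq] using this
    have key : (Matrix.fromCols W Z)ᴴ * Y j * Matrix.fromCols W Z
        = tupleDirectSum X (fun j => Zᴴ * Y j * Z) j := by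
      rw [Matrix.conjTranspose_fromCols_eq_fromRows_conjTranspose, Matrix.fromRows_mul,
        Matrix.fromRows_mul_fromCols, tupleDirectSum, Matrix.fromBlocks_inj]
      refine ⟨?_, ?_, ?_, rfl⟩
      · rw [Matrix.mul_assoc, h j, ← Matrix.mul_assoc, hW, Matrix.one_mul]
      · rw [hWY, Matrix.mul_assoc, hWZ, Matrix.mul_zero]
      · rw [Matrix.mul_assoc, h j, ← Matrix.mul_assoc, hZW, Matrix.zero_mul]
    rw [← key, Matrix.conjTranspose_conjTranspose]
    calc Y j = (Matrix.fromCols W Z * (Matrix.fromCols W Z)ᴴ) * Y j *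
        (Matrix.fromCols W Z * (Matrix.fromCols W Z)ᴴ) := by
          rw [h2, Matrix.one_mul, Matrix.mul_one]
      _ = _ := by simp only [Matrix.mul_assoc]

theorem isFreeExtremePoint_of_kernel_condition {g : ℕ} {α : Type} [Fintype α] [DecidableEq α]
    (A : Fin g → Matrix α α ℂ) {n : ℕ+} {X : Fin g → Matrix (Fin n) (Fin n) ℂ}
    (hX : X ∈ freeSpectrahedron A n)
    (hker : ∀ (d : ℕ) (D : Fin g → Matrix (Fin d) (Fin n) ℂ),
      (∀ K : Matrix (α × Fin n) (α × Fin n) ℂ,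
        (1 - ∑ j, A j ⊗ₖ X j) * K = 0 → (∑ j, A j ⊗ₖ D j) * K = 0) → D = 0)
    (hirr : ∀ M : Matrix (Fin n) (Fin n) ℂ, (∀ j, M * X j = X j * M) → ∃ c : ℂ, M = c • 1) :
    IsFreeExtremePoint (freeSpectrahedron A) n X := by
  refine ⟨hX, fun m d Y V hcomb hY hV i => ?_⟩
  -- The identity `∑ (V i)ᴴ * V i = 1` absorbs the constant term, so the whole pencil is a
  -- combination of the pencils at `Y i`.
  have hdecomp : 1 - ∑ j, A j ⊗ₖ X j = ∑ i, ((1 : Matrix α α ℂ) ⊗ₖ V i)ᴴ *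
      (1 - ∑ j, A j ⊗ₖ Y i j) * ((1 : Matrix α α ℂ) ⊗ₖ V i) := by
    simp only [Matrix.conjTranspose_kronecker, Matrix.conjTranspose_one, Matrix.mul_sub,
      Matrix.sub_mul, Matrix.mul_one, Matrix.mul_sum, Matrix.sum_mul, ← Matrix.mul_kronecker_mul,
      Matrix.one_mul, Finset.sum_sub_distrib]
    rw [Finset.sum_comm]
    simp only [hcomb.2]
    have hk : ∀ (B : Matrix α α ℂ) (f : Fin m → Matrix (Fin n) (Fin n) ℂ),
        B ⊗ₖ (∑ i, f i) = ∑ i, B ⊗ₖ f i := fun B f => by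
      ext ⟨a, b⟩ ⟨a', b'⟩
      simp [Matrix.sum_apply, Finset.mul_sum]
    simp only [← hk, hcomb.1, Matrix.one_kronecker_one]
  have hint : ∀ j, Y i j * V i = V i * X j := by
    have := hker (d i) (fun j => Y i j * V i - V i * X j) (fun K hK => ?_)
    · intro j; exact sub_eq_zero.1 (congrFun this j)
    -- Compressed to the kernel, the positive semidefinite summands add up to zero, so each of them
    -- vanishes.
    have h0 : ∑ i, (((1 : Matrix α α ℂ) ⊗ₖ V i) * K)ᴴ * (1 - ∑ j, A j ⊗ₖ Y i j) *
        (((1 : Matrix α α ℂ) ⊗ₖ V i) * K) = 0 := by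
      have h1 := congrArg (fun M => Kᴴ * M) hK
      simp only [hdecomp, Matrix.mul_zero, Matrix.sum_mul, Matrix.mul_sum] at h1
      rw [← h1]
      refine Finset.sum_congr rfl fun i _ => ?_
      rw [Matrix.conjTranspose_mul]
      simp only [Matrix.mul_assoc]
    have h2 := sum_eq_zero_of_posSemidef
      (fun i => (hY i).2.conjTranspose_mul_mul_same (((1 : Matrix α α ℂ) ⊗ₖ V i) * K)) h0 i
    have h3 := mul_eq_zero_of_posSemidef (hY i).2 _ h2
    have h4 : (∑ j, A j ⊗ₖ (Y i j * V i - V i * X j)) =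
        ((1 : Matrix α α ℂ) ⊗ₖ V i) * (1 - ∑ j, A j ⊗ₖ X j)
          - (1 - ∑ j, A j ⊗ₖ Y i j) * ((1 : Matrix α α ℂ) ⊗ₖ V i) := by
      simp only [Matrix.mul_sub, Matrix.sub_mul, Matrix.mul_one, Matrix.mul_sum, Matrix.sum_mul,
        ← Matrix.mul_kronecker_mul, Matrix.one_mul, sub_sub_sub_cancel_left,
        ← Finset.sum_sub_distrib]
      refine Finset.sum_congr rfl fun j _ => ?_
      ext ⟨a, b⟩ ⟨a', b'⟩
      simp [mul_sub]
    rw [h4, Matrix.sub_mul, Matrix.mul_assoc, hK, Matrix.mul_zero, Matrix.mul_assoc, h3, sub_zero]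
  have hcommute : ∀ j, ((V i)ᴴ * V i) * X j = X j * ((V i)ᴴ * V i) := fun j => by
    have h1 := congrArg Matrix.conjTranspose (hint j)
    simp only [Matrix.conjTranspose_mul, (hX.1 j).eq, ((hY i).1 j).eq] at h1
    rw [Matrix.mul_assoc, ← hint j, ← Matrix.mul_assoc, h1, Matrix.mul_assoc]
  obtain ⟨c, hc⟩ := hirr _ hcommute
  have hpos : 0 < c := by
    have hps := Matrix.posSemidef_conjTranspose_mul_self (V i)
    rw [hc] at hps
    have h1 := hps.diag_nonneg (i := ⟨0, n.pos⟩)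
    simp at h1
    refine lt_of_le_of_ne h1 fun h2 => hV i ?_
    rw [← h2, zero_smul] at hc
    exact Matrix.conjTranspose_mul_self_eq_zero.1 hc
  obtain ⟨r, hr, rfl⟩ : ∃ r : ℝ, 0 < r ∧ (r : ℂ) = c := by
    have := Complex.pos_iff.1 hpos
    exact ⟨c.re, this.1, Complex.ext rfl (by simp [this.2])⟩
  -- Since `(V i)ᴴ * V i = r • 1`, this factor rescales `V i` to an isometry.
  set s : ℂ := (((Real.sqrt r)⁻¹ : ℝ) : ℂ) with hs
  have hsr : s * s * r = 1 := by
    rw [hs, ← Complex.ofReal_mul, ← Complex.ofReal_mul, ← mul_inv, Real.mul_self_sqrt hr.le,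
      inv_mul_cancel₀ hr.ne', Complex.ofReal_one]
  refine unitarilyEquivalent_of_isometry (hY i).1 (s • V i) ?_ fun j => ?_
  · rw [Matrix.conjTranspose_smul, Matrix.smul_mul, Matrix.mul_smul, hc, smul_smul, smul_smul]
    have : star s = s := by simp [hs]
    rw [this, hsr, one_smul]
  · rw [Matrix.mul_smul, Matrix.smul_mul, hint j]

/-! ### Spin systems. -/

/-- Pairwise anticommuting self-adjoint unitaries. -/
structure IsSpinSystem {g : ℕ} {α : Type*} [Fintype α] [DecidableEq α]
    (A : Fin g → Matrix α α ℂ) : Prop where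
  isHermitian : ∀ j, (A j).IsHermitian
  mul_self : ∀ j, A j * A j = 1
  anticomm : ∀ j k, j ≠ k → A j * A k = -(A k * A j)

theorem sigmaZ_isHermitian : sigmaZ.IsHermitian := by
  ext i j; fin_cases i <;> fin_cases j <;> simp [sigmaZ]

theorem sigmaX_isHermitian : sigmaX.IsHermitian := by
  ext i j; fin_cases i <;> fin_cases j <;> simp [sigmaX]

theorem sigmaZ_mul_self : sigmaZ * sigmaZ = 1 := by
  ext i j; fin_cases i <;> fin_cases j <;> simp [sigmaZ]

theorem sigmaX_mul_self : sigmaX * sigmaX = 1 := by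
  ext i j; fin_cases i <;> fin_cases j <;> simp [sigmaX]

theorem sigmaX_mul_sigmaZ : sigmaX * sigmaZ = -(sigmaZ * sigmaX) := by
  ext i j; fin_cases i <;> fin_cases j <;> simp [sigmaZ, sigmaX]

theorem neg_kronecker {l m n p : Type*} (A : Matrix l m ℂ) (B : Matrix n p ℂ) :
    (-A) ⊗ₖ B = -(A ⊗ₖ B) := by
  ext; simp

theorem kronecker_neg {l m n p : Type*} (A : Matrix l m ℂ) (B : Matrix n p ℂ) :
    A ⊗ₖ (-B) = -(A ⊗ₖ B) := by
  ext; simp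

theorem IsSpinSystem.snoc {g : ℕ} {α : Type*} [Fintype α] [DecidableEq α]
    {A : Fin g → Matrix α α ℂ} (hA : IsSpinSystem A) :
    IsSpinSystem (Fin.snoc (α := fun _ => Matrix (α × Fin 2) (α × Fin 2) ℂ)
      (fun j => A j ⊗ₖ sigmaZ) (1 ⊗ₖ sigmaX)) where
  isHermitian j := by
    refine Fin.lastCases ?_ (fun j => ?_) j
    · simp [Matrix.IsHermitian, Matrix.conjTranspose_kronecker, sigmaX_isHermitian.eq]
    · simp [Matrix.IsHermitian, Matrix.conjTranspose_kronecker, sigmaZ_isHermitian.eq,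
        (hA.isHermitian j).eq]
  mul_self j := by
    refine Fin.lastCases ?_ (fun j => ?_) j
    · simp [← Matrix.mul_kronecker_mul, sigmaX_mul_self]
    · simp [← Matrix.mul_kronecker_mul, sigmaZ_mul_self, hA.mul_self]
  anticomm j k := by
    refine Fin.lastCases ?_ (fun j => ?_) j <;> refine Fin.lastCases ?_ (fun k => ?_) k
    · simp
    · intro _
      simp [← Matrix.mul_kronecker_mul, sigmaX_mul_sigmaZ, kronecker_neg]
    · intro _
      simp [← Matrix.mul_kronecker_mul, sigmaX_mul_sigmaZ, kronecker_neg]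
    · intro h
      simp only [Fin.snoc_castSucc, ← Matrix.mul_kronecker_mul]
      rw [hA.anticomm j k (fun e => h (by rw [e])), neg_kronecker]

theorem spinTuple_isSpinSystem : ∀ g, IsSpinSystem (spinTuple (g + 2))
  | 0 =>
    { isHermitian := fun j => by
        fin_cases j
        exacts [sigmaZ_isHermitian, sigmaX_isHermitian]
      mul_self := fun j => by
        fin_cases j
        exacts [sigmaZ_mul_self, sigmaX_mul_self]
      anticomm := fun j k h => by
        fin_cases j <;> fin_cases k
        · exact absurd rfl h
        · exact (neg_eq_iff_eq_neg.2 sigmaX_mul_sigmaZ).symm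
        · exact sigmaX_mul_sigmaZ
        · exact absurd rfl h }
  | g + 1 => (spinTuple_isSpinSystem g).snoc

/-- The matrix `!![0, 1; -1, 0]` anticommutes with both `sigmaZ` and `sigmaX`, so placing it in the
last tensor factor suffices. -/
theorem exists_anticomm_spinTuple (g : ℕ) :
    ∃ W : Matrix (SpinIndex (g + 3)) (SpinIndex (g + 3)) ℂ,
      W * W = -1 ∧ ∀ j, W * spinTuple (g + 3) j = -(spinTuple (g + 3) j * W) := by
  have hz : !![0, 1; -1, 0] * sigmaZ = -(sigmaZ * !![0, 1; -1, 0]) := by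
    ext i j; fin_cases i <;> fin_cases j <;> simp [sigmaZ]
  have hx : !![0, 1; -1, 0] * sigmaX = -(sigmaX * !![0, 1; -1, 0]) := by
    ext i j; fin_cases i <;> fin_cases j <;> simp [sigmaX]
  have hw : !![0, 1; -1, 0] * !![0, 1; -1, 0] = (-1 : Matrix (Fin 2) (Fin 2) ℂ) := by
    ext i j; fin_cases i <;> fin_cases j <;> simp
  refine ⟨(1 : Matrix (SpinIndex (g + 2)) (SpinIndex (g + 2)) ℂ) ⊗ₖ !![0, 1; -1, 0], ?_, ?_⟩
  · change _ = -(1 : Matrix (SpinIndex (g + 2) × Fin 2) (SpinIndex (g + 2) × Fin 2) ℂ)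
    refine (Matrix.mul_kronecker_mul _ _ _ _).symm.trans ?_
    rw [hw, kronecker_neg, Matrix.one_mul, Matrix.one_kronecker_one]
  · have : ∀ j, ((1 : Matrix (SpinIndex (g + 2)) (SpinIndex (g + 2)) ℂ) ⊗ₖ !![0, 1; -1, 0]) *
        Fin.snoc (α := fun _ => Matrix (SpinIndex (g + 2) × Fin 2) (SpinIndex (g + 2) × Fin 2) ℂ)
          (fun j => spinTuple (g + 2) j ⊗ₖ sigmaZ) (1 ⊗ₖ sigmaX) j =
        -(Fin.snoc (α := fun _ => Matrix (SpinIndex (g + 2) × Fin 2) (SpinIndex (g + 2) × Fin 2) ℂ)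
          (fun j => spinTuple (g + 2) j ⊗ₖ sigmaZ) (1 ⊗ₖ sigmaX) j *
          ((1 : Matrix (SpinIndex (g + 2)) (SpinIndex (g + 2)) ℂ) ⊗ₖ !![0, 1; -1, 0])) := by
      intro j
      refine Fin.lastCases ?_ (fun j => ?_) j
      · simp only [Fin.snoc_last, ← Matrix.mul_kronecker_mul, hx, kronecker_neg]
      · simp only [Fin.snoc_castSucc, ← Matrix.mul_kronecker_mul, hz, kronecker_neg,
          Matrix.one_mul, Matrix.mul_one]
    exact this

instance SpinIndex.instNonempty : ∀ g, Nonempty (SpinIndex g)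
  | 0 => ⟨(0 : Fin 2)⟩
  | 1 => ⟨(0 : Fin 2)⟩
  | 2 => ⟨(0 : Fin 2)⟩
  | g + 3 => by
    obtain ⟨a⟩ := SpinIndex.instNonempty (g + 2)
    exact ⟨((a, 0) : SpinIndex (g + 2) × Fin 2)⟩

/-! ### Pencils equal to their cube. -/

/-- Sorting the letters `a`, `b`, `c` in the expanded cube leaves only the words `a`, `b`, `c` and
`abc`. The hypotheses `hx`, `hy`, `hz` and `h0` prescribe their coefficients. -/
theorem sum_pow_three_of_anticomm {R : Type*} [Ring R] {a b c x y z : R}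
    (haa : a * a = 1) (hbb : b * b = 1) (hcc : c * c = 1)
    (hba : b * a = -(a * b)) (hca : c * a = -(a * c)) (hcb : c * b = -(b * c))
    (hxa : x * a = a * x) (hxb : x * b = b * x) (hxc : x * c = c * x)
    (hya : y * a = a * y) (hyb : y * b = b * y) (hyc : y * c = c * y)
    (hza : z * a = a * z) (hzb : z * b = b * z) (hzc : z * c = c * z)
    (hx : x * (x * x) + (x * (y * y) + y * (y * x) - y * (x * y))
      + (x * (z * z) + z * (z * x) - z * (x * z)) = x)
    (hy : y * (y * y) + (y * (x * x) + x * (x * y) - x * (y * x))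
      + (y * (z * z) + z * (z * y) - z * (y * z)) = y)
    (hz : z * (z * z) + (z * (x * x) + x * (x * z) - x * (z * x))
      + (z * (y * y) + y * (y * z) - y * (z * y)) = z)
    (h0 : x * (y * z) + y * (z * x) + z * (x * y) - y * (x * z) - x * (z * y) - z * (y * x) = 0) :
    (a * x + b * y + c * z) * ((a * x + b * y + c * z) * (a * x + b * y + c * z))
      = a * x + b * y + c * z := by
  -- In right-associated words a letter `a`, `b` or `c` is never last, so the relations with a
  -- trailing factor are enough for the sorting.
  have assoc : ∀ {p q r : R}, p * q = r → ∀ t, p * (q * t) = r * t := fun h t => by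
    rw [← mul_assoc, h]
  have key : (a * x + b * y + c * z) * ((a * x + b * y + c * z) * (a * x + b * y + c * z))
      = a * (x * (x * x) + (x * (y * y) + y * (y * x) - y * (x * y))
          + (x * (z * z) + z * (z * x) - z * (x * z)))
        + b * (y * (y * y) + (y * (x * x) + x * (x * y) - x * (y * x))
          + (y * (z * z) + z * (z * y) - z * (y * z)))
        + c * (z * (z * z) + (z * (x * x) + x * (x * z) - x * (z * x))
          + (z * (y * y) + y * (y * z) - y * (z * y)))
        + a * (b * (c * (x * (y * z) + y * (z * x) + z * (x * y) - y * (x * z) - x * (z * y)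
          - z * (y * x)))) := by
    simp only [mul_add, add_mul, mul_sub, mul_assoc, assoc haa, assoc hbb, assoc hcc, assoc hba,
      assoc hca, assoc hcb, assoc hxa, assoc hxb, assoc hxc, assoc hya, assoc hyb, assoc hyc,
      assoc hza, assoc hzb, assoc hzc, neg_mul, mul_neg, one_mul, neg_neg]
    abel
  rw [key, hx, hy, hz, h0, mul_zero, mul_zero, mul_zero, add_zero]

/-- Here `1 - T * T` and `(T * T - T) / 2` are the projections onto the eigenspaces for 0 and -1,
and `1 - T` is the first plus twice the second. -/
theorem posSemidef_one_sub_of_pow_three {m : Type*} [Fintype m] [DecidableEq m]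
    {T : Matrix m m ℂ} (hT : T.IsHermitian) (h3 : T * (T * T) = T) : (1 - T).PosSemidef := by
  have h4 : T * (T * (T * T)) = T * T := by rw [h3]
  have hP : (1 - T * T)ᴴ = 1 - T * T := by simp [hT.eq]
  have hQ : (T * T - T)ᴴ = T * T - T := by simp [hT.eq]
  have h : 1 - T = (1 - T * T)ᴴ * (1 - T * T) + (2⁻¹ : ℂ) • ((T * T - T)ᴴ * (T * T - T)) := by
    have e1 : (1 - T * T) * (1 - T * T) = 1 - T * T := by
      simp only [Matrix.mul_sub, Matrix.sub_mul, Matrix.mul_one, Matrix.one_mul, Matrix.mul_assoc,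
        h4]
      abel
    have e2 : (T * T - T) * (T * T - T) = (2 : ℂ) • (T * T - T) := by
      simp only [Matrix.mul_sub, Matrix.sub_mul, Matrix.mul_assoc, h3, two_smul]
      abel
    rw [hP, hQ, e1, e2, smul_smul]
    norm_num
  rw [h]
  refine (Matrix.posSemidef_conjTranspose_mul_self _).add
    ((Matrix.posSemidef_conjTranspose_mul_self _).smul ?_)
  simp

/-! ### Annihilation relations between pencils of a spin system. -/

theorem one_kronecker_eq_zero {α m n : Type*} [DecidableEq α] [Nonempty α] {E : Matrix m n ℂ}
    (h : (1 : Matrix α α ℂ) ⊗ₖ E = 0) : E = 0 := by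
  obtain ⟨a⟩ := ‹Nonempty α›
  ext i j
  simpa using congrFun (congrFun h (a, i)) (a, j)

theorem anticomm_sum_kronecker {g : ℕ} {α : Type*} [Fintype α] {A : Fin g → Matrix α α ℂ}
    {W : Matrix α α ℂ} (hWA : ∀ j, W * A j = -(A j * W))
    {m n : Type*} [Fintype m] [DecidableEq m] [Fintype n] [DecidableEq n]
    (E : Fin g → Matrix m n ℂ) :
    (W ⊗ₖ (1 : Matrix m m ℂ)) * ∑ j, A j ⊗ₖ E j =
      -((∑ j, A j ⊗ₖ E j) * (W ⊗ₖ (1 : Matrix n n ℂ))) := by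
  simp only [Matrix.mul_sum, Matrix.sum_mul, ← Matrix.mul_kronecker_mul, Matrix.one_mul,
    Matrix.mul_one, hWA, neg_kronecker, Finset.sum_neg_distrib]

section

variable {g : ℕ} {α : Type*} [Fintype α] [DecidableEq α] {A : Fin g → Matrix α α ℂ}

/-- The factor `A j` anticommutes with `∑ k, A k ⊗ E k` up to the term `2 (1 ⊗ E j)`. -/
theorem IsSpinSystem.mul_sum_kronecker (hA : IsSpinSystem A) {m n : Type*} [Fintype m]
    [DecidableEq m] [Fintype n] [DecidableEq n] (E : Fin g → Matrix m n ℂ) (j : Fin g) :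
    (A j ⊗ₖ (1 : Matrix m m ℂ)) * ∑ k, A k ⊗ₖ E k =
      (2 : ℂ) • ((1 : Matrix α α ℂ) ⊗ₖ E j)
        - (∑ k, A k ⊗ₖ E k) * (A j ⊗ₖ (1 : Matrix n n ℂ)) := by
  have h : ∀ k, (A j * A k) ⊗ₖ E k =
      (if k = j then (2 : ℂ) • ((1 : Matrix α α ℂ) ⊗ₖ E j) else 0) - (A k * A j) ⊗ₖ E k := by
    intro k
    split_ifs with hk
    · rw [hk, hA.mul_self, two_smul, add_sub_cancel_right]
    · rw [hA.anticomm j k (Ne.symm hk), neg_kronecker, zero_sub]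
  simp only [Matrix.mul_sum, Matrix.sum_mul, ← Matrix.mul_kronecker_mul, Matrix.one_mul,
    Matrix.mul_one, h, Finset.sum_sub_distrib, Finset.sum_ite_eq', Finset.mem_univ, if_true]

theorem IsSpinSystem.isHermitian_sum_kronecker (hA : IsSpinSystem A) {n : Type*}
    {X : Fin g → Matrix n n ℂ} (hX : ∀ j, (X j).IsHermitian) :
    (∑ j, A j ⊗ₖ X j).IsHermitian := by
  rw [Matrix.IsHermitian, Matrix.conjTranspose_sum]
  refine Finset.sum_congr rfl fun j _ => ?_
  rw [Matrix.conjTranspose_kronecker, (hA.isHermitian j).eq, (hX j).eq]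

theorem IsSpinSystem.eq_zero_of_sum_kronecker [Nonempty α] (hA : IsSpinSystem A) {m n : Type*}
    [Fintype m] [DecidableEq m] [Fintype n] [DecidableEq n] {E : Fin g → Matrix m n ℂ}
    (h : ∑ k, A k ⊗ₖ E k = 0) : E = 0 := by
  ext1 j
  have := hA.mul_sum_kronecker E j
  rw [h, Matrix.mul_zero, Matrix.zero_mul, sub_zero, eq_comm, smul_eq_zero] at this
  exact one_kronecker_eq_zero (this.resolve_left two_ne_zero)

/-- Moving `A j` through the product isolates the terms with index `j`, and independence of the `A
k` gives the exchange relation. Symmetrizing the product then leaves only the diagonal, as `A j * A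
k + A k * A j` vanishes off it. -/
theorem IsSpinSystem.mul_comm_of_sum_mul_sum [Nonempty α] (hA : IsSpinSystem A) {m n : Type*}
    [Fintype m] [DecidableEq m] [Fintype n] [DecidableEq n] {D : Fin g → Matrix m n ℂ}
    {X : Fin g → Matrix n n ℂ} (h : (∑ j, A j ⊗ₖ D j) * ∑ k, A k ⊗ₖ X k = 0) :
    (∀ j k, D j * X k = D k * X j) ∧ ∑ j, D j * X j = 0 := by
  have h1 : ∀ j k, D j * X k = D k * X j := by
    intro j k
    have hsum : ∑ k, A k ⊗ₖ (D j * X k - D k * X j) = 0 := by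
      set B := ∑ j, A j ⊗ₖ D j with hB
      set T := ∑ k, A k ⊗ₖ X k with hT
      have e1 := hA.mul_sum_kronecker D j
      have e2 := hA.mul_sum_kronecker X j
      rw [← hB] at e1
      rw [← hT] at e2
      have e3 : (2 : ℂ) • (((1 : Matrix α α ℂ) ⊗ₖ D j) * T - B * ((1 : Matrix α α ℂ) ⊗ₖ X j)) = 0 := by
        have e4 : (A j ⊗ₖ (1 : Matrix m m ℂ)) * (B * T) = 0 := by rw [h, Matrix.mul_zero]
        rw [← Matrix.mul_assoc, e1, Matrix.sub_mul, Matrix.mul_assoc, e2, Matrix.mul_sub,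
          ← Matrix.mul_assoc B T, h, Matrix.zero_mul, sub_zero, Matrix.smul_mul,
          Matrix.mul_smul] at e4
        rw [smul_sub, e4]
      have e5 := (smul_eq_zero.1 e3).resolve_left two_ne_zero
      rw [← e5, hB, hT, Matrix.mul_sum, Matrix.sum_mul, ← Finset.sum_sub_distrib]
      refine Finset.sum_congr rfl fun k _ => ?_
      rw [← Matrix.mul_kronecker_mul, ← Matrix.mul_kronecker_mul, Matrix.one_mul, Matrix.mul_one]
      ext ⟨a, b⟩ ⟨a', b'⟩
      simp [mul_sub]
    exact sub_eq_zero.1 (congrFun (hA.eq_zero_of_sum_kronecker hsum) k)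
  refine ⟨h1, ?_⟩
  have h2 : (2 : ℂ) • ((1 : Matrix α α ℂ) ⊗ₖ ∑ j, D j * X j) = 0 := by
    have e : ∀ B C : Matrix α α ℂ, ∀ M : Matrix m n ℂ, B ⊗ₖ M + C ⊗ₖ M = (B + C) ⊗ₖ M := by
      intro B C M
      ext
      simp [add_mul]
    have hs : ∑ j, ∑ k, (A j * A k) ⊗ₖ (D j * X k) = 0 := by
      rw [Finset.sum_comm]
      simpa only [Matrix.mul_sum, Matrix.sum_mul, ← Matrix.mul_kronecker_mul] using h
    have hs' : ∑ j, ∑ k, (A k * A j) ⊗ₖ (D j * X k) = 0 := by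
      rw [Finset.sum_comm, ← hs]
      refine Finset.sum_congr rfl fun j _ => Finset.sum_congr rfl fun k _ => ?_
      rw [h1]
    have ht : ∀ j k, (A j * A k) ⊗ₖ (D j * X k) + (A k * A j) ⊗ₖ (D j * X k) =
        if k = j then (2 : ℂ) • ((1 : Matrix α α ℂ) ⊗ₖ (D j * X j)) else 0 := by
      intro j k
      split_ifs with hk
      · rw [hk, hA.mul_self, two_smul]
      · rw [e, hA.anticomm j k (Ne.symm hk), neg_add_cancel, Matrix.zero_kronecker]
    have hu : ∑ j, ∑ k, ((A j * A k) ⊗ₖ (D j * X k) + (A k * A j) ⊗ₖ (D j * X k)) = 0 := by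
      simp only [Finset.sum_add_distrib, hs, hs', add_zero]
    simp only [ht, Finset.sum_ite_eq', Finset.mem_univ, if_true, ← Finset.smul_sum] at hu
    rw [← hu]
    congr 1
    ext ⟨a, b⟩ ⟨a', b'⟩
    simp [Matrix.sum_apply, Finset.mul_sum]
  exact one_kronecker_eq_zero ((smul_eq_zero.1 h2).resolve_left two_ne_zero)

/-- If `T = ∑ j, A j ⊗ X j` satisfies `T ^ 3 = T`, then the range of `T ^ 2 + T` lies in the kernel
of `1 - T`; this determines the tuples `D` for which `∑ j, A j ⊗ D j` vanishes on that kernel. -/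
theorem IsSpinSystem.mul_comm_of_vanish_on_ker [Nonempty α] (hA : IsSpinSystem A)
    {W : Matrix α α ℂ} (hW : W * W = -1) (hWA : ∀ j, W * A j = -(A j * W)) {m n : Type*}
    [Fintype m] [DecidableEq m] [Fintype n] [DecidableEq n] {D : Fin g → Matrix m n ℂ}
    {X : Fin g → Matrix n n ℂ}
    (h3 : (∑ j, A j ⊗ₖ X j) * ((∑ j, A j ⊗ₖ X j) * ∑ j, A j ⊗ₖ X j) = ∑ j, A j ⊗ₖ X j)
    (hD : ∀ K : Matrix (α × n) (α × n) ℂ, (1 - ∑ j, A j ⊗ₖ X j) * K = 0 →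
      (∑ j, A j ⊗ₖ D j) * K = 0) :
    (∀ j k, D j * X k = D k * X j) ∧ ∑ j, D j * X j = 0 := by
  refine hA.mul_comm_of_sum_mul_sum ?_
  have fD := anticomm_sum_kronecker hWA D
  have fX := anticomm_sum_kronecker hWA X
  set B := ∑ j, A j ⊗ₖ D j
  set T := ∑ j, A j ⊗ₖ X j
  have h1 : B * (T * T + T) = 0 := hD _ (by
    rw [Matrix.sub_mul, Matrix.one_mul, Matrix.mul_add, h3]
    abel)
  -- Both `B` and `T` change sign when `W ⊗ 1` passes through them, which turns `T * T + T` into `T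
  -- * T - T`.
  have h2 : B * (T * T - T) * (W ⊗ₖ (1 : Matrix n n ℂ)) = 0 := by
    have e := congrArg (fun M => (W ⊗ₖ (1 : Matrix m m ℂ)) * M) h1
    simp only [Matrix.mul_zero] at e
    rw [← Matrix.mul_assoc, fD, Matrix.neg_mul, Matrix.mul_assoc, Matrix.mul_add,
      ← Matrix.mul_assoc _ T T, fX, Matrix.neg_mul, Matrix.mul_assoc T, fX, Matrix.mul_neg,
      neg_neg, ← sub_eq_add_neg, neg_eq_zero, ← Matrix.mul_assoc T, ← Matrix.sub_mul,
      ← Matrix.mul_assoc] at e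
    exact e
  have h4 : B * (T * T - T) = 0 := by
    have e := congrArg (fun M => M * (W ⊗ₖ (1 : Matrix n n ℂ))) h2
    simp only [Matrix.zero_mul] at e
    rw [Matrix.mul_assoc, ← Matrix.mul_kronecker_mul, hW, Matrix.one_mul, neg_kronecker,
      Matrix.one_kronecker_one, Matrix.mul_neg, Matrix.mul_one, neg_eq_zero] at e
    exact e
  have h5 : (2 : ℂ) • (B * T) = B * (T * T + T) - B * (T * T - T) := by
    rw [Matrix.mul_add, Matrix.mul_sub, two_smul]
    abel
  rw [h1, h4, sub_zero] at h5
  exact (smul_eq_zero.1 h5).resolve_left two_ne_zero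

end

/-! ### An irreducible triple of size 7. -/

/-- Three symmetric integer matrices whose halves form the first three entries of a free extreme
point of the free spectrahedron of the spin tuple. -/
def cubicTriple : Fin 3 → Matrix (Fin 7) (Fin 7) ℤ :=
  ![!![0, 1, 0, 0, 0, 0, 0; 1, 0, 0, 0, 0, 0, 0; 0, 0, 0, 0, 0, 0, 0; 0, 0, 0, 0, 0, 1, 0;
      0, 0, 0, 0, 0, 1, -1; 0, 0, 0, 1, 1, 0, 0; 0, 0, 0, 0, -1, 0, 0],
    !![0, 0, 0, 1, 0, 0, 0; 0, 0, 0, 0, 0, 1, 1; 0, 0, 0, 0, 0, 0, -1; 1, 0, 0, 0, 0, 0, 0;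
      0, 0, 0, 0, 0, 0, 0; 0, 1, 0, 0, 0, 0, 0; 0, 1, -1, 0, 0, 0, 0],
    !![0, 0, 0, 0, 0, 1, 0; 0, 0, 0, 1, 0, 0, 0; 0, 0, 0, 1, -1, 0, 0; 0, 1, 1, 0, 0, 0, 0;
      0, 0, -1, 0, 0, 0, 0; 1, 0, 0, 0, 0, 0, 0; 0, 0, 0, 0, 0, 0, 0]]

/-- The complex matrices `cubicTriple l / 2`. -/
noncomputable def halfTriple (l : Fin 3) : Matrix (Fin 7) (Fin 7) ℂ :=
  (2⁻¹ : ℂ) • (cubicTriple l).map (Int.castRingHom ℂ)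

theorem cubicTriple_transpose (l : Fin 3) : (cubicTriple l)ᵀ = cubicTriple l := by
  revert l; decide

/-- Over the integers the identity is decidable. The factor 4 comes from halving: cubic terms scale
by 1/8, linear ones by 1/2. -/
theorem cubicTriple_cubic (l b c : Fin 3) (hb : l ≠ b) (hc : l ≠ c) (hbc : b ≠ c) :
    cubicTriple l * (cubicTriple l * cubicTriple l)
      + (cubicTriple l * (cubicTriple b * cubicTriple b)
        + cubicTriple b * (cubicTriple b * cubicTriple l)
        - cubicTriple b * (cubicTriple l * cubicTriple b))
      + (cubicTriple l * (cubicTriple c * cubicTriple c)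
        + cubicTriple c * (cubicTriple c * cubicTriple l)
        - cubicTriple c * (cubicTriple l * cubicTriple c)) = 4 • cubicTriple l := by
  revert l b c; decide +kernel

theorem cubicTriple_alternating :
    cubicTriple 0 * (cubicTriple 1 * cubicTriple 2) + cubicTriple 1 * (cubicTriple 2 * cubicTriple 0)
      + cubicTriple 2 * (cubicTriple 0 * cubicTriple 1)
      - cubicTriple 1 * (cubicTriple 0 * cubicTriple 2)
      - cubicTriple 0 * (cubicTriple 2 * cubicTriple 1)
      - cubicTriple 2 * (cubicTriple 1 * cubicTriple 0) = 0 := by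
  decide +kernel

theorem halfTriple_isHermitian (l : Fin 3) : (halfTriple l).IsHermitian := by
  have h := cubicTriple_transpose l
  ext i j
  have := congrFun (congrFun h i) j
  simp only [Matrix.transpose_apply] at this
  simp [halfTriple, this]

theorem halfTriple_cubic (l b c : Fin 3) (hb : l ≠ b) (hc : l ≠ c) (hbc : b ≠ c) :
    halfTriple l * (halfTriple l * halfTriple l)
      + (halfTriple l * (halfTriple b * halfTriple b) + halfTriple b * (halfTriple b * halfTriple l)
        - halfTriple b * (halfTriple l * halfTriple b))
      + (halfTriple l * (halfTriple c * halfTriple c) + halfTriple c * (halfTriple c * halfTriple l)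
        - halfTriple c * (halfTriple l * halfTriple c)) = halfTriple l := by
  have h := congrArg (Int.castRingHom ℂ).mapMatrix (cubicTriple_cubic l b c hb hc hbc)
  simp only [map_add, map_sub, map_mul, map_nsmul, RingHom.mapMatrix_apply] at h
  simp only [halfTriple, Matrix.smul_mul, Matrix.mul_smul, ← smul_add, ← smul_sub, h]
  rw [← Nat.cast_smul_eq_nsmul ℂ]
  simp only [smul_smul]
  norm_num

theorem halfTriple_alternating :
    halfTriple 0 * (halfTriple 1 * halfTriple 2) + halfTriple 1 * (halfTriple 2 * halfTriple 0)
      + halfTriple 2 * (halfTriple 0 * halfTriple 1) - halfTriple 1 * (halfTriple 0 * halfTriple 2)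
      - halfTriple 0 * (halfTriple 2 * halfTriple 1)
      - halfTriple 2 * (halfTriple 1 * halfTriple 0) = 0 := by
  have h := congrArg (Int.castRingHom ℂ).mapMatrix cubicTriple_alternating
  simp only [map_add, map_sub, map_mul, map_zero, RingHom.mapMatrix_apply] at h
  simp only [halfTriple, Matrix.smul_mul, Matrix.mul_smul, ← smul_add, ← smul_sub, h, smul_zero]

/-- The rows of `D` decouple: each index `i` gives 28 linear equations in 21 unknowns, with only the
zero solution. -/
theorem eq_zero_of_mul_halfTriple {ι : Type*} (D : Fin 3 → Matrix ι (Fin 7) ℂ)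
    (h : ∀ j k, D j * halfTriple k = D k * halfTriple j)
    (h0 : D 0 * halfTriple 0 + D 1 * halfTriple 1 + D 2 * halfTriple 2 = 0) : D = 0 := by
  have e0 := fun i c => congrFun (congrFun h0 i) c
  have e1 := fun i c => congrFun (congrFun (h 0 1) i) c
  have e2 := fun i c => congrFun (congrFun (h 0 2) i) c
  have e3 := fun i c => congrFun (congrFun (h 1 2) i) c
  ext j i c
  replace e0 := e0 i
  replace e1 := e1 i
  replace e2 := e2 i
  replace e3 := e3 i
  simp [Fin.forall_fin_succ, Matrix.mul_apply, halfTriple, cubicTriple, Fin.sum_univ_succ] at e0 e1 e2 e3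
  fin_cases j <;> fin_cases c <;> simp <;> grind

theorem eq_smul_one_of_commute_halfTriple {M : Matrix (Fin 7) (Fin 7) ℂ}
    (h : ∀ l, M * halfTriple l = halfTriple l * M) : ∃ c : ℂ, M = c • 1 := by
  refine ⟨M 2 2, ?_⟩
  have hrow : ∀ l r c, ∑ k, M r k * halfTriple l k c = ∑ k, halfTriple l r k * M k c := by
    intro l r c
    simpa [Matrix.mul_apply] using congrFun (congrFun (h l) r) c
  -- Row 2 of `halfTriple 0` is zero, so row 2 of `M` lies in the left kernel of this matrix, which
  -- is spanned by the basis vector with index 2.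
  have h2 : ∀ c, c ≠ 2 → M 2 c = 0 := by
    have e := hrow 0 2
    simp [Fin.forall_fin_succ, halfTriple, cubicTriple, Fin.sum_univ_succ] at e ⊢
    grind
  rw [← sub_eq_zero]
  set N := M - M 2 2 • 1 with hN
  have hNl : ∀ l, N * halfTriple l = halfTriple l * N := fun l => by
    simp [hN, Matrix.sub_mul, Matrix.mul_sub, h l]
  -- A vanishing row of `N` yields linear relations among its other rows; starting from row 2, they
  -- kill all rows one after another.
  have key : ∀ l r, N r = 0 → ∑ k, halfTriple l r k • N k = 0 := by
    intro l r hr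
    ext c
    have := congrFun (congrFun (hNl l) r) c
    rw [Matrix.mul_apply, Matrix.mul_apply, hr] at this
    simpa using this.symm
  have n2 : N 2 = 0 := by
    ext c
    by_cases hc : c = 2
    · simp [hN, hc]
    · simp [hN, h2 c hc, Ne.symm hc]
  have n6 : N 6 = 0 := by simpa [halfTriple, cubicTriple, Fin.sum_univ_succ] using key 1 2 n2
  have n4 : N 4 = 0 := by simpa [halfTriple, cubicTriple, Fin.sum_univ_succ] using key 0 6 n6
  have n3 : N 3 = 0 := by simpa [halfTriple, cubicTriple, Fin.sum_univ_succ, n4] using key 2 2 n2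
  have n5 : N 5 = 0 := by simpa [halfTriple, cubicTriple, Fin.sum_univ_succ, n6] using key 0 4 n4
  have n1 : N 1 = 0 := by simpa [halfTriple, cubicTriple, Fin.sum_univ_succ, n2] using key 1 6 n6
  have n0 : N 0 = 0 := by simpa [halfTriple, cubicTriple, Fin.sum_univ_succ] using key 0 1 n1
  refine funext fun r => ?_
  fin_cases r <;> assumption

/-! ### Padding to length `g`. -/

/-- The tuple `halfTriple`, followed by `h` zero matrices. -/
noncomputable def paddedTriple (h : ℕ) : Fin (h + 3) → Matrix (Fin 7) (Fin 7) ℂ :=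
  Matrix.vecCons (halfTriple 0) (Matrix.vecCons (halfTriple 1) (Matrix.vecCons (halfTriple 2) 0))

theorem forall_fin_add_three {h : ℕ} {P : Fin (h + 3) → Prop} :
    (∀ j, P j) ↔ P 0 ∧ P 1 ∧ P 2 ∧ ∀ j : Fin h, P j.succ.succ.succ := by
  simp only [Fin.forall_fin_succ, Fin.succ_zero_eq_one, Fin.succ_one_eq_two]

section

variable (h : ℕ)

@[simp] theorem paddedTriple_zero : paddedTriple h 0 = halfTriple 0 := rfl
@[simp] theorem paddedTriple_one : paddedTriple h 1 = halfTriple 1 := rfl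
@[simp] theorem paddedTriple_two : paddedTriple h 2 = halfTriple 2 := rfl
@[simp] theorem paddedTriple_succ (j : Fin h) : paddedTriple h j.succ.succ.succ = 0 := rfl

theorem paddedTriple_isHermitian (j : Fin (h + 3)) : (paddedTriple h j).IsHermitian := by
  revert j
  simp [forall_fin_add_three, halfTriple_isHermitian]

theorem sum_kronecker_paddedTriple {α : Type*} (A : Fin (h + 3) → Matrix α α ℂ) :
    ∑ j, A j ⊗ₖ paddedTriple h j =
      A 0 ⊗ₖ halfTriple 0 + A 1 ⊗ₖ halfTriple 1 + A 2 ⊗ₖ halfTriple 2 := by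
  simp only [Fin.sum_univ_succ, Fin.succ_zero_eq_one, Fin.succ_one_eq_two, paddedTriple_zero,
    paddedTriple_one, paddedTriple_two, paddedTriple_succ, Matrix.kronecker_zero,
    Finset.sum_const_zero, add_zero, add_assoc]

theorem IsSpinSystem.sum_kronecker_paddedTriple_pow_three {α : Type*} [Fintype α] [DecidableEq α]
    {A : Fin (h + 3) → Matrix α α ℂ} (hA : IsSpinSystem A) :
    (∑ j, A j ⊗ₖ paddedTriple h j) *
      ((∑ j, A j ⊗ₖ paddedTriple h j) * ∑ j, A j ⊗ₖ paddedTriple h j) =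
      ∑ j, A j ⊗ₖ paddedTriple h j := by
  let φ : Matrix (Fin 7) (Fin 7) ℂ →+* Matrix (α × Fin 7) (α × Fin 7) ℂ :=
    { toFun := fun M => (1 : Matrix α α ℂ) ⊗ₖ M
      map_one' := Matrix.one_kronecker_one
      map_mul' := fun M N => by rw [← Matrix.mul_kronecker_mul, Matrix.one_mul]
      map_zero' := Matrix.kronecker_zero _
      map_add' := Matrix.kronecker_add _ }
  have hsplit : ∀ j l, A j ⊗ₖ halfTriple l = (A j ⊗ₖ 1) * φ (halfTriple l) := fun j l => by
    change _ = _ * (1 : Matrix α α ℂ) ⊗ₖ _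
    rw [← Matrix.mul_kronecker_mul, Matrix.one_mul, Matrix.mul_one]
  have hcomm : ∀ l j, φ (halfTriple l) * (A j ⊗ₖ 1) = (A j ⊗ₖ 1) * φ (halfTriple l) := fun l j => by
    rw [← hsplit]
    change (1 : Matrix α α ℂ) ⊗ₖ _ * _ = _
    rw [← Matrix.mul_kronecker_mul, Matrix.one_mul, Matrix.mul_one]
  have hsq : ∀ j, (A j ⊗ₖ (1 : Matrix (Fin 7) (Fin 7) ℂ)) * (A j ⊗ₖ 1) = 1 := fun j => by
    rw [← Matrix.mul_kronecker_mul, hA.mul_self, Matrix.one_mul, Matrix.one_kronecker_one]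
  have hanti : ∀ j k, j ≠ k → (A j ⊗ₖ (1 : Matrix (Fin 7) (Fin 7) ℂ)) * (A k ⊗ₖ 1) =
      -((A k ⊗ₖ 1) * (A j ⊗ₖ 1)) := fun j k hjk => by
    rw [← Matrix.mul_kronecker_mul, ← Matrix.mul_kronecker_mul, hA.anticomm j k hjk, neg_kronecker]
  have hcubic : ∀ l b c, l ≠ b → l ≠ c → b ≠ c → _ := fun l b c hb hc hbc =>
    congrArg φ (halfTriple_cubic l b c hb hc hbc)
  have halt := congrArg φ halfTriple_alternating
  simp only [map_add, map_sub, map_mul, map_zero] at hcubic halt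
  rw [sum_kronecker_paddedTriple, hsplit, hsplit, hsplit]
  have h01 : (0 : Fin (h + 3)) ≠ 1 := by simp
  have h02 : (0 : Fin (h + 3)) ≠ 2 := fun e =>
    absurd (congrArg Fin.val e) (by simp [Nat.mod_eq_of_lt (show 2 < h + 3 by omega)])
  have h12 : (1 : Fin (h + 3)) ≠ 2 := fun e =>
    absurd (congrArg Fin.val e) (by simp [Nat.mod_eq_of_lt (show 2 < h + 3 by omega)])
  exact sum_pow_three_of_anticomm (hsq 0) (hsq 1) (hsq 2) (hanti 1 0 h01.symm)
    (hanti 2 0 h02.symm) (hanti 2 1 h12.symm) (hcomm _ _) (hcomm _ _) (hcomm _ _) (hcomm _ _)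
    (hcomm _ _) (hcomm _ _) (hcomm _ _) (hcomm _ _) (hcomm _ _)
    (hcubic 0 1 2 (by decide) (by decide) (by decide))
    (hcubic 1 0 2 (by decide) (by decide) (by decide))
    (hcubic 2 0 1 (by decide) (by decide) (by decide)) halt

theorem eq_zero_of_mul_paddedTriple {ι : Type*} {D : Fin (h + 3) → Matrix ι (Fin 7) ℂ}
    (hD : ∀ j k, D j * paddedTriple h k = D k * paddedTriple h j)
    (h0 : ∑ j, D j * paddedTriple h j = 0) : D = 0 := by
  have h3 : ![D 0, D 1, D 2] = 0 := by
    refine eq_zero_of_mul_halfTriple _ (fun j k => ?_) ?_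
    · fin_cases j <;> fin_cases k
      exacts [rfl, hD 0 1, hD 0 2, hD 1 0, rfl, hD 1 2, hD 2 0, hD 2 1, rfl]
    · rw [← h0]
      simp [Fin.sum_univ_succ, Fin.succ_zero_eq_one, Fin.succ_one_eq_two, add_assoc]
  have hrest : ∀ j : Fin h, D j.succ.succ.succ = 0 := fun j => by
    have e : ∀ k, D j.succ.succ.succ * paddedTriple h k = 0 := fun k => by
      rw [hD, paddedTriple_succ, Matrix.mul_zero]
    -- An entry of `D` at a padded position annihilates the whole triple, so the triple with this
    -- entry and two zeros satisfies the same equations.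
    have := eq_zero_of_mul_halfTriple ![D j.succ.succ.succ, 0, 0] (fun a b => ?_) ?_
    · exact congrFun this 0
    · fin_cases a <;> fin_cases b <;> simp [← paddedTriple_zero h, ← paddedTriple_one h,
        ← paddedTriple_two h, e, -paddedTriple_zero, -paddedTriple_one, -paddedTriple_two]
    · simpa using e 0
  exact funext (forall_fin_add_three.2 ⟨congrFun h3 0, congrFun h3 1, congrFun h3 2, hrest⟩)

theorem paddedTriple_isFreeExtremePoint :
    IsFreeExtremePoint (freeSpectrahedron (spinTuple (h + 3))) ⟨7, by norm_num⟩
      (paddedTriple h) := by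
  have hA : IsSpinSystem (spinTuple (h + 3)) := spinTuple_isSpinSystem (h + 1)
  obtain ⟨W, hW, hWA⟩ := exists_anticomm_spinTuple h
  have hT := hA.sum_kronecker_paddedTriple_pow_three h
  refine isFreeExtremePoint_of_kernel_condition _
    ⟨paddedTriple_isHermitian h, posSemidef_one_sub_of_pow_three
      (hA.isHermitian_sum_kronecker (paddedTriple_isHermitian h)) hT⟩ (fun d D hD => ?_)
    fun M hM => eq_smul_one_of_commute_halfTriple fun l => ?_
  · obtain ⟨h1, h2⟩ := hA.mul_comm_of_vanish_on_ker hW hWA hT hD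
    exact eq_zero_of_mul_paddedTriple h h1 h2
  · fin_cases l
    exacts [hM 0, hM 1, hM 2]

end

/-! ### Free extreme points of the minimal matrix convex set. -/

theorem of_const_eq_smul_one {κ : Type*} [DecidableEq κ] [Subsingleton κ] (c : ℂ) :
    (Matrix.of fun _ _ => c : Matrix κ κ ℂ) = c • 1 := by
  ext a b
  simp [Subsingleton.elim a b]

theorem conjTranspose_mul_self_apply_of_subsingleton {κ : Type*} [Fintype κ] [Subsingleton κ]
    (v : Matrix κ κ ℂ) (a : κ) : (vᴴ * v) a a = ((Complex.normSq (v a a) : ℝ) : ℂ) := by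
  rw [Matrix.mul_apply, Complex.normSq_eq_conj_mul_self]
  exact Fintype.sum_eq_single a fun b hb => absurd (Subsingleton.elim b a) hb

instance subsingleton_fin_pnat_one : Subsingleton (Fin (1 : ℕ+)) :=
  inferInstanceAs (Subsingleton (Fin 1))

section

variable {g : ℕ}

/-- The matrix convex combinations of the points of `C`. -/
def matrixConvexHull (C : Set (EuclideanSpace ℝ (Fin g))) : MatrixSet g := fun n =>
  {X | ∃ (ι : Type) (_ : Fintype ι) (x : ι → EuclideanSpace ℝ (Fin g))
    (v : ι → Matrix (Fin (1 : ℕ+)) (Fin n) ℂ), (∀ i, x i ∈ C) ∧ ∑ i, (v i)ᴴ * v i = 1 ∧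
      ∀ j, X j = ∑ i, (x i j : ℂ) • ((v i)ᴴ * v i)}

theorem isMatrixConvex_matrixConvexHull (C : Set (EuclideanSpace ℝ (Fin g))) :
    IsMatrixConvex (matrixConvexHull C) := by
  intro m n X d Y V hcomb hY
  choose ι hι x v hx hv hYv using hY
  refine ⟨Σ i, ι i, inferInstance, fun p => x p.1 p.2, fun p => v p.1 p.2 * V p.1,
    fun p => hx p.1 p.2, ?_, fun j => ?_⟩
  · rw [Fintype.sum_sigma, ← hcomb.1]
    refine Finset.sum_congr rfl fun i _ => ?_
    calc _ = (V i)ᴴ * (∑ k, (v i k)ᴴ * v i k) * V i := by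
          simp only [Matrix.conjTranspose_mul, Matrix.mul_sum, Matrix.sum_mul, Matrix.mul_assoc]
      _ = _ := by rw [hv, Matrix.mul_one]
  · rw [Fintype.sum_sigma, hcomb.2]
    refine Finset.sum_congr rfl fun i _ => ?_
    rw [hYv]
    simp only [Matrix.conjTranspose_mul, Matrix.mul_sum, Matrix.sum_mul, Matrix.mul_assoc,
      Matrix.mul_smul, Matrix.smul_mul]

/-- At level one the coefficients act as the convex weights `|v i| ^ 2`, so convexity of `C`
prevents new points. -/
theorem matrixConvexHull_one {C : Set (EuclideanSpace ℝ (Fin g))} (hC : Convex ℝ C) :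
    matrixConvexHull C 1 = levelOne C := by
  ext X
  constructor
  · rintro ⟨ι, _, x, v, hx, hv, hX⟩
    refine ⟨∑ i, Complex.normSq (v i 0 0) • x i, hC.sum_mem (fun i _ => Complex.normSq_nonneg _) ?_
      fun i _ => hx i, fun j a b => ?_⟩
    · have := congrFun (congrFun hv 0) 0
      rw [Matrix.sum_apply, Matrix.one_apply_eq] at this
      simp only [conjTranspose_mul_self_apply_of_subsingleton _ (0 : Fin (1 : ℕ+))] at this
      exact_mod_cast this
    · rw [Subsingleton.elim a 0, Subsingleton.elim b 0, hX, Matrix.sum_apply]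
      simp only [Matrix.smul_apply, conjTranspose_mul_self_apply_of_subsingleton _ (0 : Fin (1 : ℕ+))]
      simp [mul_comm]
  · rintro ⟨x, hx, hX⟩
    refine ⟨Unit, inferInstance, fun _ => x, fun _ => 1, fun _ => hx, ?_, fun j => ?_⟩
    · rw [Fintype.sum_unique, Matrix.conjTranspose_one, Matrix.mul_one]
    · rw [Fintype.sum_unique, Matrix.conjTranspose_one, Matrix.mul_one, ← of_const_eq_smul_one]
      exact Matrix.ext fun a b => hX j a b

theorem levelOne_subset_minimalMatrixConvexSet (C : Set (EuclideanSpace ℝ (Fin g))) :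
    levelOne C ⊆ minimalMatrixConvexSet C 1 :=
  fun _ hX _ _ hK => hK ▸ hX

theorem IsFreeExtremePoint.eq_one_of_minimal {C : Set (EuclideanSpace ℝ (Fin g))}
    (hC : Convex ℝ C) {n : ℕ+} {X : Fin g → Matrix (Fin n) (Fin n) ℂ}
    (hX : IsFreeExtremePoint (minimalMatrixConvexSet C) n X) : n = 1 := by
  classical
  obtain ⟨ι, _, x, v, hx, hv, hXv⟩ :=
    hX.1 _ (isMatrixConvex_matrixConvexHull C) (matrixConvexHull_one hC)
  -- Free extremality only concerns nonzero coefficients, so the vanishing ones are discarded.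
  let e := (Fintype.equivFin {i // v i ≠ 0}).symm
  have hsum : ∀ f : ι → Matrix (Fin n) (Fin n) ℂ, (∀ i, v i = 0 → f i = 0) →
      ∑ i, f (e i) = ∑ i, f i := fun f hf => by
    rw [e.sum_comp (fun i : {i // v i ≠ 0} => f i)]
    rw [← Finset.sum_subtype (Finset.univ.filter fun i => v i ≠ 0) 
      (fun i => Finset.mem_filter.trans (and_iff_right (Finset.mem_univ i))) f]
    exact Finset.sum_filter_of_ne fun i _ hi h0 => hi (hf i h0)
  have hcomb : IsMatrixConvexCombination X (fun _ => 1)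
      (fun i j => (Matrix.of fun _ _ => (x (e i) j : ℂ))) (fun i => v (e i)) := by
    refine ⟨by rw [hsum (fun i => (v i)ᴴ * v i) (fun i hi => by rw [hi, Matrix.mul_zero]), hv], fun j => ?_⟩
    rw [hXv, ← hsum _ (fun i hi => by rw [hi, Matrix.mul_zero, smul_zero])]
    refine Finset.sum_congr rfl fun i _ => ?_
    change _ = (v (e i))ᴴ * (Matrix.of fun _ _ => (x (e i) j : ℂ)) * v (e i)
    rw [of_const_eq_smul_one, Matrix.mul_smul, Matrix.mul_one, Matrix.smul_mul]
  have hmem := hX.2 _ _ _ _ hcomb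
    (fun i => levelOne_subset_minimalMatrixConvexSet C ⟨x (e i), hx _, fun _ _ _ => rfl⟩)
    (fun i => (e i).2)
  obtain ⟨i⟩ : Nonempty (Fin (Fintype.card {i // v i ≠ 0})) := by
    by_contra hempty
    rw [not_nonempty_iff] at hempty
    have h1 := hcomb.1
    rw [Finset.univ_eq_empty, Finset.sum_empty] at h1
    simpa using congrFun (congrFun h1 ⟨0, n.pos⟩) ⟨0, n.pos⟩
  -- A scalar point is unitarily equivalent to `X` or `X ⊕ Z`; comparing sizes leaves `n = 1`, as `1
  -- = n + k` is impossible.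
  rcases hmem i with ⟨U, h1, h2, -⟩ | ⟨k, Z, U, h1, h2, -⟩
  · have := card_eq_of_mul_eq_one h1 h2
    rw [Fintype.card_fin, Fintype.card_fin] at this
    exact PNat.eq this
  · have := card_eq_of_mul_eq_one h1 h2
    have hk := k.pos
    have hn := n.pos
    rw [Fintype.card_sum, Fintype.card_fin, Fintype.card_fin, Fintype.card_fin, PNat.one_coe] at this
    omega

end

theorem mainTheorem2 (g : ℕ) (hg : 3 ≤ g) :
    (∃ (n : ℕ+) (X : Fin g → Matrix (Fin n) (Fin n) ℂ),
      6 ≤ n ∧ IsFreeExtremePoint (freeSpectrahedron (spinTuple g)) n X) ∧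
    freeSpectrahedron (spinTuple g) ≠
      minimalMatrixConvexSet (Metric.closedBall (0 : EuclideanSpace ℝ (Fin g)) 1) := by
  obtain ⟨h, rfl⟩ := Nat.exists_eq_add_of_le' hg
  have hX := paddedTriple_isFreeExtremePoint h
  refine ⟨⟨_, _, PNat.coe_le_coe _ _ |>.1 (by norm_num), hX⟩, fun heq => ?_⟩
  rw [heq] at hX
  have := hX.eq_one_of_minimal (convex_closedBall _ _)
  exact absurd (congrArg PNat.val this) (by norm_num)
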